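/- Let $\Omega\subset\mathbb R^2$ be an open convex polygon, and let $x_1,\dots,x_M\in\overline\Omega$ be distinct nodes which include all vertices of $\Omega$. Let $\omega$ be the set of nodes lying in $\Omega$ (the interior nodes). For each $i$ let $P_i=\{x\in\mathbb R^2 : |x-x_i|<|x-x_j| \text{ for all } j\ne i\}$ be the Voronoi polygon of $x_i$, let $\Omega_i=P_i\cap\Omega$ be its control volume, and let $V_i$ be the area of $\Omega_i$. For $i\neq j$ let $\Gamma_{ij}=\partial\Omega_i\cap\partial\Omega_j$, let $l_{ij}$ be the length of $\Gamma_{ij}$, $d_{ij}=|x_i-x_j|$, $x_{ij}=\frac12(x_i+x_j)$, and $\mathcal W(i)=\{j\ne i : l_{ij}>0\}$. Let $\bm v:\mathbb R^2\to\mathbb R^2$ be a vector field and let $b_{ij}=\bm v(x_{ij})\cdot (x_j-x_i)/d_{ij}$ be its component along the outer normal of $\Omega_i$ on $\Gamma_{ij}$, taken at $x_{ij}$. Let $H=L_2(\omega)$ be the space of real functions $y=(y_i)$ on the nodes that vanish at all nodes on $\partial\Omega$, with the scalar product $(y,w)=\sum_{x_i\in\omega}V_iy_iw_i$ and the norm $\|y\|=(y,y)^{1/2}$.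 For $y\in H$ and $x_i\in\omega$ put $$(C_1y)_i=\frac1{V_i}\sum_{j\in\mathcal W(i)}l_{ij}b_{ij}\frac{y_j-y_i}2,\qquad (C_2y)_i=\frac1{V_i}\sum_{j\in\mathcal W(i)}l_{ij}b_{ij}\frac{y_j+y_i}2,\qquad (C_0y)_i=\frac1{2V_i}\sum_{j\in\mathcal W(i)}l_{ij}b_{ij}y_j,$$ $$(Dy)_i=-\frac1{V_i}\sum_{j\in\mathcal W(i)}l_{ij}k(x_{ij})\frac{y_j-y_i}{d_{ij}},\qquad (\mathrm{div}_h\bm v)_i=\frac1{V_i}\sum_{j\in\mathcal W(i)}l_{ij}b_{ij},$$ where $k$ is a real function with $k(x)\ge\kappa_1>0$ for all $x\in\Omega$. Let $\|\mathrm{div}_h\bm v\|_\infty=\max_{x_i\in\omega}|(\mathrm{div}_h\bm v)_i|$ and $B=\max_{x_i\in\omega}\max_{j\in\mathcal W(i)}|b_{ij}|^2$ (both read as $0$ if $\omega=\emptyset$). Then: 1. $C_1^*=-C_2$ and $C_0^*=-C_0$ in $H$. 2. $|(C_\alpha y,y)|\le\frac12\|\mathrm{div}_h\bm v\|_\infty\|y\|^2$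 for all $y\in H$ and $\alpha=1,2$. 3. $\|C_1y\|^2\le M_2\,(Dy,y)$ for all $y\in H$, with $M_2=\frac2{\kappa_1}B$. Suppose moreover that the control volumes of the interior nodes are whole Voronoi polygons, that is, $P_i\subset\overline\Omega$ for all $x_i\in\omega$, and that $\Omega$ is contained in a rectangle with sides of lengths $l_1,l_2$ parallel to the coordinate axes. Put $M_0=\frac{l_1^2}{16}+\frac{l_2^2}{16}$. Then $\|Cy\|^2\le M_2\,(Dy,y)$ for all $y\in H$ also holds for $C=C_2$ with $M_2=\frac2{\kappa_1}\left(2B+M_0\|\mathrm{div}_h\bm v\|_\infty^2\right)$ and for $C=C_0$ with $M_2=\frac1{\kappa_1}\left(3B+M_0\|\mathrm{div}_h\bm v\|_\infty^2\right)$. -/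

import Mathlib

open MeasureTheory

/-- The Euclidean plane. -/
abbrev Plane : Type := EuclideanSpace ℝ (Fin 2)

/-- A grid of `M` distinct nodes in a closed convex polygon such that all the vertices of the
polygon are nodes. -/
structure VoronoiGrid (M : ℕ) where
  /-- the (open) computational domain `Ω` -/
  domain : Set Plane
  /-- a finite set of points spanning the polygon (its vertices) -/
  vertices : Finset Plane
  domain_eq : domain = interior (convexHull ℝ (vertices : Set Plane))
  domain_nonempty : domain.Nonempty
  /-- the nodes `x₁, …, x_M` -/
  node : Fin M → Plane
  node_injective : Function.Injective node
  vertices_subset : (vertices : Set Plane) ⊆ Set.range node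
  node_mem : ∀ i, node i ∈ closure domain

namespace VoronoiGrid

noncomputable section

variable {M : ℕ} (G : VoronoiGrid M)

/-! ### Geometry of the grid -/

open Classical in
/-- The (indices of the) interior nodes `ω`, i.e. the nodes that lie in the open domain. -/
def interiorNodes : Finset (Fin M) := Finset.univ.filter fun i => G.node i ∈ G.domain

/-- The (full, unclipped) Voronoi polygon of the node `i`: the points of the plane that lie closer
to this node than to all the other ones. -/
def voronoiPolygon (i : Fin M) : Set Plane :=
  {x | ∀ j, j ≠ i → dist x (G.node i) < dist x (G.node j)}

/-- The control volume `Ω_i`: the part of the Voronoi polygon belonging to `Ω`. -/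
def controlVolume (i : Fin M) : Set Plane := G.voronoiPolygon i ∩ G.domain

/-- The common face `Γ_ij = ∂Ω_i ∩ ∂Ω_j` of two control volumes. -/
def face (i j : Fin M) : Set Plane :=
  frontier (G.controlVolume i) ∩ frontier (G.controlVolume j)

/-- The area `V_i` of the control volume. -/
def V (i : Fin M) : ℝ := volume.real (G.controlVolume i)

/-- The length `l_ij` of the common face (one-dimensional Hausdorff measure). -/
def l (i j : Fin M) : ℝ := (Measure.hausdorffMeasure 1 : Measure Plane).real (G.face i j)

/-- The distance `d(x_i, x_j)` between two nodes. -/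
def d (i j : Fin M) : ℝ := dist (G.node i) (G.node j)

/-- The midpoint `x_ij` of the segment connecting two nodes. -/
def mid (i j : Fin M) : Plane := midpoint ℝ (G.node i) (G.node j)

open Classical in
/-- The neighbours `W(i)` of the node `i`: the other nodes whose control volumes have a common face
(of positive length) with the control volume of `i`. -/
def neighbors (i : Fin M) : Finset (Fin M) :=
  Finset.univ.filter fun j => j ≠ i ∧ 0 < G.l i j

/-- The normal velocity component `b_ij = (v, n)(x_ij)`. The face `Γ_ij` lies on the perpendicular
bisector of the segment from `x_i` to `x_j`, so that its unit normal pointing out of `Ω_i` is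
`n = (x_j - x_i) / d(x_i, x_j)`. -/
def b (v : Plane → Plane) (i j : Fin M) : ℝ :=
  inner ℝ (v (G.mid i j)) ((G.d i j)⁻¹ • (G.node j - G.node i))

theorem controlVolume_isOpen (i : Fin M) : IsOpen (G.controlVolume i) := by
  apply IsOpen.inter
  · have h : G.voronoiPolygon i =
        ⋂ j, ⋂ (_ : j ≠ i), {x | dist x (G.node i) < dist x (G.node j)} := by
      ext x; simp [voronoiPolygon]
    rw [h]
    refine isOpen_iInter_of_finite fun j => isOpen_iInter_of_finite fun _ => ?_
    exact isOpen_lt (by fun_prop) (by fun_prop)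
  · rw [G.domain_eq]; exact isOpen_interior

theorem V_pos {i : Fin M} (hi : i ∈ G.interiorNodes) : 0 < G.V i := by
  have hmem : G.node i ∈ G.domain := by simpa [interiorNodes] using hi
  have hne : (G.controlVolume i).Nonempty := by
    refine ⟨G.node i, fun j hj => ?_, hmem⟩
    rw [dist_self]
    exact dist_pos.2 fun h => hj (G.node_injective h).symm
  have hpos : 0 < volume (G.controlVolume i) := (G.controlVolume_isOpen i).measure_pos volume hne
  have hb : Bornology.IsBounded (G.controlVolume i) := by
    have hc : Bornology.IsBounded (convexHull ℝ (G.vertices : Set Plane)) :=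
      isBounded_convexHull.2 G.vertices.finite_toSet.isBounded
    refine hc.subset fun x hx => ?_
    have := hx.2
    rw [G.domain_eq] at this
    exact interior_subset this
  exact ENNReal.toReal_pos hpos.ne' hb.measure_lt_top.ne

/-! ### The space `H = L₂(ω)` -/

/-- The linear space of the grid functions that vanish at the boundary nodes. -/
def gridSubmodule : Submodule ℝ (Fin M → ℝ) where
  carrier := {y | ∀ i, i ∉ G.interiorNodes → y i = 0}
  add_mem' := fun ha hb i hi => by simp [ha i hi, hb i hi]
  zero_mem' := fun _ _ => rfl
  smul_mem' := fun c y hy i hi => by simp [hy i hi]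

/-- The space `H = L₂(ω)` of the grid functions that vanish at the boundary nodes; it carries the
scalar product `(y, w) = ∑_{x_i ∈ ω} V_i y_i w_i`. -/
def H : Type := G.gridSubmodule

instance : AddCommGroup G.H := inferInstanceAs (AddCommGroup G.gridSubmodule)

instance : Module ℝ G.H := inferInstanceAs (Module ℝ G.gridSubmodule)

instance : FiniteDimensional ℝ G.H := inferInstanceAs (FiniteDimensional ℝ G.gridSubmodule)

instance : CoeFun G.H (fun _ => Fin M → ℝ) := ⟨fun y => y.1⟩

/-- The scalar product of `H`. -/
@[reducible]
def innerCore : InnerProductSpace.Core ℝ G.H where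
  inner y w := ∑ i ∈ G.interiorNodes, G.V i * y i * w i
  conj_inner_symm y w := by
    simp only [conj_trivial]
    exact Finset.sum_congr rfl fun i _ => by ring
  re_inner_nonneg y := by
    simp only [RCLike.re_to_real]
    refine Finset.sum_nonneg fun i hi => ?_
    rw [mul_assoc]
    exact mul_nonneg (G.V_pos hi).le (mul_self_nonneg _)
  add_left x y w := by
    rw [← Finset.sum_add_distrib]
    refine Finset.sum_congr rfl fun i _ => ?_
    change G.V i * (x i + y i) * w i = _
    ring
  smul_left x y r := by
    simp only [conj_trivial]
    rw [Finset.mul_sum]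
    refine Finset.sum_congr rfl fun i _ => ?_
    change G.V i * (r * x i) * y i = _
    ring
  definite y h := by
    have h0 : ∀ i ∈ G.interiorNodes, 0 ≤ G.V i * y i * y i := fun i hi => by
      rw [mul_assoc]
      exact mul_nonneg (G.V_pos hi).le (mul_self_nonneg _)
    have h1 := (Finset.sum_eq_zero_iff_of_nonneg h0).1 h
    refine Subtype.ext (funext fun i => ?_)
    by_cases hi : i ∈ G.interiorNodes
    · have h2 := h1 i hi
      rw [mul_assoc] at h2
      exact mul_self_eq_zero.1 ((mul_eq_zero.1 h2).resolve_left (G.V_pos hi).ne')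
    · exact y.2 i hi

instance : NormedAddCommGroup G.H := G.innerCore.toNormedAddCommGroup

instance : InnerProductSpace ℝ G.H := InnerProductSpace.ofCore G.innerCore.toCore

theorem inner_eq (y w : G.H) : inner ℝ y w = ∑ i ∈ G.interiorNodes, G.V i * y i * w i := rfl

/-! ### The grid operators -/

/-- A linear operator in `H` from a linear expression for its values at the interior nodes. -/
def mkOp (L : Fin M → (Fin M → ℝ) → ℝ)
    (hadd : ∀ i y w, L i (y + w) = L i y + L i w) (hsmul : ∀ i (c : ℝ) y, L i (c • y) = c * L i y) :
    G.H →ₗ[ℝ] G.H where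
  toFun y := ⟨fun i => if i ∈ G.interiorNodes then L i y else 0, fun i hi => if_neg hi⟩
  map_add' y w := by
    refine Subtype.ext (funext fun i => ?_)
    change (if i ∈ G.interiorNodes then L i (y.1 + w.1) else 0) =
      (if i ∈ G.interiorNodes then L i y.1 else 0) + (if i ∈ G.interiorNodes then L i w.1 else 0)
    split_ifs <;> simp [hadd]
  map_smul' c y := by
    refine Subtype.ext (funext fun i => ?_)
    change (if i ∈ G.interiorNodes then L i (c • y.1) else 0) =
      c * (if i ∈ G.interiorNodes then L i y.1 else 0)
    split_ifs <;> simp [hsmul]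

/-- Diffusive transport:
`(D y)_i = -(1 / V_i) ∑_{j ∈ W(i)} l_ij k(x_ij) (y_j - y_i) / d(x_i, x_j)`. -/
def D (k : Plane → ℝ) : G.H →ₗ[ℝ] G.H :=
  G.mkOp (fun i y => -(1 / G.V i * ∑ j ∈ G.neighbors i,
      G.l i j * k (G.mid i j) * ((y j - y i) / G.d i j)))
    (fun i y w => by
      rw [← neg_add, ← mul_add, ← Finset.sum_add_distrib]
      refine congrArg (fun s => -(1 / G.V i * s)) (Finset.sum_congr rfl fun j _ => ?_)
      simp only [Pi.add_apply]; ring)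
    (fun i c y => by
      simp only [Finset.mul_sum, ← Finset.sum_neg_distrib, Pi.smul_apply, smul_eq_mul]
      exact Finset.sum_congr rfl fun j _ => by ring)

/-- Convective transport, nondivergent form:
`(C₁ y)_i = (1 / V_i) ∑_{j ∈ W(i)} l_ij b_ij (y_j - y_i) / 2`. -/
def C₁ (v : Plane → Plane) : G.H →ₗ[ℝ] G.H :=
  G.mkOp (fun i y => 1 / G.V i * ∑ j ∈ G.neighbors i, G.l i j * G.b v i j * ((y j - y i) / 2))
    (fun i y w => by
      rw [← mul_add, ← Finset.sum_add_distrib]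
      refine congrArg (fun s => 1 / G.V i * s) (Finset.sum_congr rfl fun j _ => ?_)
      simp only [Pi.add_apply]; ring)
    (fun i c y => by
      simp only [Finset.mul_sum, Pi.smul_apply, smul_eq_mul]
      exact Finset.sum_congr rfl fun j _ => by ring)

/-- Convective transport, divergent form:
`(C₂ y)_i = (1 / V_i) ∑_{j ∈ W(i)} l_ij b_ij (y_j + y_i) / 2`. -/
def C₂ (v : Plane → Plane) : G.H →ₗ[ℝ] G.H :=
  G.mkOp (fun i y => 1 / G.V i * ∑ j ∈ G.neighbors i, G.l i j * G.b v i j * ((y j + y i) / 2))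
    (fun i y w => by
      rw [← mul_add, ← Finset.sum_add_distrib]
      refine congrArg (fun s => 1 / G.V i * s) (Finset.sum_congr rfl fun j _ => ?_)
      simp only [Pi.add_apply]; ring)
    (fun i c y => by
      simp only [Finset.mul_sum, Pi.smul_apply, smul_eq_mul]
      exact Finset.sum_congr rfl fun j _ => by ring)

/-- Convective transport, skew-symmetric form:
`(C₀ y)_i = (1 / (2 V_i)) ∑_{j ∈ W(i)} l_ij b_ij y_j`. -/
def C₀ (v : Plane → Plane) : G.H →ₗ[ℝ] G.H :=
  G.mkOp (fun i y => 1 / (2 * G.V i) * ∑ j ∈ G.neighbors i, G.l i j * G.b v i j * y j)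
    (fun i y w => by
      rw [← mul_add, ← Finset.sum_add_distrib]
      refine congrArg (fun s => 1 / (2 * G.V i) * s) (Finset.sum_congr rfl fun j _ => ?_)
      simp only [Pi.add_apply]; ring)
    (fun i c y => by
      simp only [Finset.mul_sum, Pi.smul_apply, smul_eq_mul]
      exact Finset.sum_congr rfl fun j _ => by ring)

/-- The grid divergence `(div_h v)_i = (1 / V_i) ∑_{j ∈ W(i)} l_ij b_ij`. -/
def divh (v : Plane → Plane) (i : Fin M) : ℝ :=
  1 / G.V i * ∑ j ∈ G.neighbors i, G.l i j * G.b v i j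

/-- The norm `‖div_h v‖_∞ = max_{x_i ∈ ω} |(div_h v)_i|` (`0` if there is no interior node). -/
def divhNorm (v : Plane → Plane) : ℝ := ⨆ i : G.interiorNodes, |G.divh v i|

/-- The quantity `max_{x_i ∈ ω} max_{j ∈ W(i)} |b_ij|²`. -/
def bMaxSq (v : Plane → Plane) : ℝ :=
  ⨆ i : G.interiorNodes, ⨆ j : G.neighbors i, |G.b v i j| ^ 2

end

end VoronoiGrid

/-!
The operators are governed by two weights on the faces: `l_ij b_ij`, which is antisymmetric, and
`l_ij / d_ij`, which is symmetric. Since a grid function of `H` vanishes at the boundary nodes, the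
sums over interior nodes extend to sums over all ordered pairs of nodes. Antisymmetry then gives
the adjoints, and with `C₂ = C₁ + div_h v` it gives the energy estimates
`(C₂ y, y) = -(C₁ y, y) = ½ (div_h v y, y)`. Symmetry and summation by parts give
`(D y, y) ≥ (κ₁ / 2) E(y)` with the Dirichlet energy `E(y) = ∑_{i,j} (l_ij / d_ij) (y_j - y_i)²`
over ordered pairs.

The estimate of `C₁` is the Cauchy inequality together with `∑_j l_ij d_ij ≤ 4 V_i`
(`sum_l_mul_d_le`): the triangles with apex `x_i` over the faces have the areas `l_ij d_ij / 4`, lie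
in the convex set `Ω_i`, and overlap only in null sets, because two faces of `Ω_i` share at most
one point.

The estimates of `C₂` and `C₀` reduce to that of `C₁` by the discrete Friedrichs inequality
`‖y‖² ≤ (M₀ / 2) E(y)` (`norm_sq_le_energy`). If `P_i` lies in the closed polygon, the triangles
with an apex `p` in `Ω_i` fill `Ω_i` up to a null set, so that
`∑_j l_ij ⟪n_ij, x_ij - p⟫ = 2 V_i`; this identity is affine in `p` and hence holds for all points
`p` of the plane (`sum_l_mul_height_eq_two_mul_V`). Taking for `p` the centre `c` of the rectangle,
it says that `φ = K - |x - c|² / 4` solves the discrete Poisson equation with right-hand side `1`.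
For `K > M₀` this function is positive at all nodes and at most `K`, and Picone's inequality bounds
the lowest eigenvalue of the discrete Laplacian from below by `1 / K`.
-/

open Filter Topology

/-! ### The area of a triangle -/

/-- The open cone (triangle) with apex `p` over a subset `F` of the line `⟪q - p, n⟫ = h`: the
points `x` strictly between `p` and the point at which the ray from `p` through `x` meets that
line, provided that this point belongs to `F`. -/
def coneOver (p n : Plane) (h : ℝ) (F : Set Plane) : Set Plane :=
  {x | inner ℝ n (x - p) ∈ Set.Ioo 0 h ∧ p + (h / inner ℝ n (x - p)) • (x - p) ∈ F}

theorem measurableSet_coneOver (p n : Plane) (h : ℝ) {F : Set Plane} (hF : MeasurableSet F) :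
    MeasurableSet (coneOver p n h F) := by
  have h1 : Measurable fun x : Plane => inner ℝ n (x - p) := by fun_prop
  have h2 : Measurable fun x : Plane => p + (h / inner ℝ n (x - p)) • (x - p) :=
    measurable_const.add ((measurable_const.div h1).smul (measurable_id.sub_const p))
  exact (h1 measurableSet_Ioo).inter (h2 hF)

theorem exists_orthonormalBasis_zero_eq {n : Plane} (hn : ‖n‖ = 1) :
    ∃ b : OrthonormalBasis (Fin 2) ℝ Plane, b 0 = n := by
  have h : Orthonormal ℝ (({0} : Set (Fin 2)).domRestrict fun _ => n) := by
    refine ⟨fun _ => hn, fun i j hij => ?_⟩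
    exact absurd (Subsingleton.elim i j) hij
  obtain ⟨b, hb⟩ := h.exists_orthonormalBasis_extension_of_card_eq (by simp)
  exact ⟨b, hb 0 rfl⟩

theorem measurePreserving_coords (b : OrthonormalBasis (Fin 2) ℝ Plane) (p : Plane) :
    MeasurePreserving
      (fun x : Plane => ((inner ℝ (b 0) (x - p), inner ℝ (b 1) (x - p)) : ℝ × ℝ)) := by
  have h := (volume_preserving_finTwoArrow ℝ).comp
    ((EuclideanSpace.volume_preserving_symm_measurableEquiv_toLp (Fin 2)).comp
      (b.repr.measurePreserving.comp (measurePreserving_sub_right volume p)))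
  have e : (fun x : Plane => ((inner ℝ (b 0) (x - p), inner ℝ (b 1) (x - p)) : ℝ × ℝ)) =
      MeasurableEquiv.finTwoArrow ∘ (MeasurableEquiv.toLp 2 (Fin 2 → ℝ)).symm ∘ b.repr ∘
        fun x => x - p := by
    ext x <;> simp [← b.repr_apply_apply]
  rw [e]
  exact h

theorem lintegral_ofReal_div_Ioo {h : ℝ} (hh : 0 < h) :
    ∫⁻ s in Set.Ioo 0 h, ENNReal.ofReal (s / h) = ENNReal.ofReal (h / 2) := by
  rw [← ofReal_integral_eq_lintegral_ofReal]
  · rw [← integral_Ioc_eq_integral_Ioo, ← intervalIntegral.integral_of_le hh.le,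
      intervalIntegral.integral_div, integral_id]
    congr 1; field_simp; ring
  · have : IntegrableOn (fun s : ℝ => s / h) (Set.Icc 0 h) :=
      (by fun_prop : Continuous fun s : ℝ => s / h).continuousOn.integrableOn_Icc
    exact this.mono_set Set.Ioo_subset_Icc_self
  · filter_upwards [self_mem_ae_restrict measurableSet_Ioo] with s hs
    exact div_nonneg hs.1.le hh.le

/-- The area of a triangle is half of the base times the height. -/
theorem volume_coneOver {p n : Plane} {h : ℝ} {F : Set Plane} (hn : ‖n‖ = 1) (hh : 0 < h)
    (hF : MeasurableSet F) (hFh : ∀ q ∈ F, inner ℝ n (q - p) = h) :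
    volume (coneOver p n h F) = ENNReal.ofReal (h / 2) * Measure.hausdorffMeasure 1 F := by
  obtain ⟨b, rfl⟩ := exists_orthonormalBasis_zero_eq hn
  have hb1 : ‖b 1‖ = 1 := b.norm_eq_one 1
  set T : Set ℝ := {t | p + h • b 0 + t • b 1 ∈ F} with hT
  have hTm : MeasurableSet T :=
    (by fun_prop : Measurable fun t : ℝ => p + h • b 0 + t • b 1) hF
  have hsum : ∀ y : Plane, y = inner ℝ (b 0) y • b 0 + inner ℝ (b 1) y • b 1 := fun y => by
    simpa using (b.sum_repr' y).symm
  -- the base `F` is isometric to `T`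
  have hFT : Measure.hausdorffMeasure 1 F = volume T := by
    have hiso : Isometry fun t : ℝ => p + h • b 0 + t • b 1 := by
      refine Isometry.of_dist_eq fun s t => ?_
      rw [dist_add_left, dist_eq_norm, ← sub_smul, norm_smul, hb1, mul_one, Real.dist_eq,
        Real.norm_eq_abs]
    have himg : F = (fun t : ℝ => p + h • b 0 + t • b 1) '' T := by
      ext q
      constructor
      · intro hq
        have h1 : p + h • b 0 + inner ℝ (b 1) (q - p) • b 1 = q := by
          conv_lhs => rw [← hFh q hq, add_assoc, ← hsum (q - p)]
          abel
        exact ⟨inner ℝ (b 1) (q - p), by simpa [hT, h1] using hq, h1⟩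
      · rintro ⟨t, ht, rfl⟩
        exact ht
    rw [himg, hiso.hausdorffMeasure_image (Or.inl zero_le_one), hausdorffMeasure_real]
  set S : Set (ℝ × ℝ) := {z | z.1 ∈ Set.Ioo 0 h ∧ h / z.1 * z.2 ∈ T} with hS
  have hSm : MeasurableSet S := (measurable_fst measurableSet_Ioo).inter
    ((by fun_prop : Measurable fun z : ℝ × ℝ => h / z.1 * z.2) hTm)
  have hpre : coneOver p (b 0) h F =
      (fun x : Plane => ((inner ℝ (b 0) (x - p), inner ℝ (b 1) (x - p)) : ℝ × ℝ)) ⁻¹' S := by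
    ext x
    refine and_congr_right fun hx => ?_
    have hs : inner ℝ (b 0) (x - p) ≠ 0 := hx.1.ne'
    have h1 : p + (h / inner ℝ (b 0) (x - p)) • (x - p) =
        p + h • b 0 + (h / inner ℝ (b 0) (x - p) * inner ℝ (b 1) (x - p)) • b 1 := by
      conv_lhs => rw [hsum (x - p)]
      simp only [inner_add_right, real_inner_smul_right, b.inner_eq_ite]
      simp only [smul_add, smul_smul]
      simp [div_mul_cancel₀ _ hs, add_assoc]
    simp only [hT, Set.mem_ofPred_eq, h1]
  rw [hpre, (measurePreserving_coords b p).measure_preimage hSm.nullMeasurableSet, hFT,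
    Measure.volume_eq_prod, Measure.prod_apply hSm]
  -- the slice of the triangle at the height `s` is the base shrunk by the factor `s / h`
  have hslice : ∀ s : ℝ, volume (Prod.mk s ⁻¹' S) =
      (Set.Ioo 0 h).indicator (fun s => ENNReal.ofReal (s / h) * volume T) s := by
    intro s
    by_cases hs : s ∈ Set.Ioo 0 h
    · have h1 : Prod.mk s ⁻¹' S = (fun t => h / s * t) ⁻¹' T := by
        ext t; simp only [hS, Set.mem_preimage, Set.mem_ofPred_eq, hs, true_and]
      rw [Set.indicator_of_mem hs, h1, Real.volume_preimage_mul_left (div_pos hh hs.1).ne',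
        inv_div, abs_of_pos (div_pos hs.1 hh)]
    · have h1 : Prod.mk s ⁻¹' S = ∅ := by
        ext t; simp only [hS, Set.mem_preimage, Set.mem_ofPred_eq, hs, false_and,
          Set.mem_empty_iff_false]
      rw [Set.indicator_of_notMem hs, h1, measure_empty]
  simp_rw [hslice]
  rw [lintegral_indicator measurableSet_Ioo, lintegral_mul_const _ (by fun_prop),
    lintegral_ofReal_div_Ioo hh]

/-! ### Convex sets and bisectors -/

theorem exists_ray_param_of_mem_coneOver {p n x : Plane} {h : ℝ} {F : Set Plane}
    (hx : x ∈ coneOver p n h F) :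
    ∃ t ∈ Set.Ioo (0 : ℝ) 1, p + t⁻¹ • (x - p) ∈ F ∧ t⁻¹ = h / inner ℝ n (x - p) := by
  obtain ⟨⟨h0, h1⟩, h2⟩ := hx
  have e : (inner ℝ n (x - p) / h)⁻¹ = h / inner ℝ n (x - p) := inv_div _ _
  exact ⟨inner ℝ n (x - p) / h, ⟨div_pos h0 (h0.trans h1), (div_lt_one (h0.trans h1)).2 h1⟩,
    by rwa [e], e⟩

theorem coneOver_subset_of_convex {p n : Plane} {h : ℝ} {F K : Set Plane} (hK : Convex ℝ K)
    (hKo : IsOpen K) (hp : p ∈ K) (hF : F ⊆ closure K) : coneOver p n h F ⊆ K := by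
  intro x hx
  obtain ⟨t, ht, hq, -⟩ := exists_ray_param_of_mem_coneOver hx
  have h1 := hK.openSegment_interior_closure_subset_interior (by rwa [hKo.interior_eq]) (hF hq)
  rw [hKo.interior_eq] at h1
  refine h1 ⟨1 - t, t, by linarith [ht.2], ht.1, by ring, ?_⟩
  rw [smul_add, smul_smul, mul_inv_cancel₀ ht.1.ne', one_smul, sub_smul, one_smul]
  abel

/-- A ray from an interior point of a convex set meets the frontier at most once. -/
theorem eq_of_mem_frontier_of_ray {p y : Plane} {K : Set Plane} (hK : Convex ℝ K)
    (hKo : IsOpen K) (hp : p ∈ K) {t s : ℝ} (ht : 0 < t) (hs : 0 < s)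
    (hqt : p + t • y ∈ frontier K) (hqs : p + s • y ∈ frontier K) : t = s := by
  have key : ∀ {t s : ℝ}, 0 < s → s < t → p + t • y ∈ frontier K → p + s • y ∉ frontier K := by
    intro t s hs hst hqt hqs
    have ht : 0 < t := hs.trans hst
    have h1 := hK.openSegment_interior_closure_subset_interior (by rwa [hKo.interior_eq])
      (frontier_subset_closure hqt)
    refine hqs.2 (h1 ⟨1 - s / t, s / t, by rw [sub_pos, div_lt_one ht]; exact hst,
      div_pos hs ht, by ring, ?_⟩)
    rw [smul_add, smul_smul, div_mul_cancel₀ _ ht.ne', ← add_assoc, ← add_smul]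
    simp
  rcases lt_trichotomy t s with h | h | h
  · exact (key ht h hqs hqt).elim
  · exact h
  · exact (key hs h hqt hqs).elim

theorem inner_sub_sub_midpoint (a c x : Plane) :
    inner ℝ (c - a) (x - midpoint ℝ a c) = (dist x a ^ 2 - dist x c ^ 2) / 2 := by
  have h1 : x - midpoint ℝ a c = (2 : ℝ)⁻¹ • ((x - a) + (x - c)) := by
    rw [midpoint_eq_smul_add, invOf_eq_inv]
    module
  have h2 : c - a = (x - a) - (x - c) := by abel
  rw [dist_eq_norm, dist_eq_norm, h1, h2, real_inner_smul_right]
  generalize x - a = u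
  generalize x - c = w
  rw [inner_add_right, inner_sub_left, inner_sub_left, real_inner_self_eq_norm_sq,
    real_inner_self_eq_norm_sq, real_inner_comm w u]
  ring

/-- At most one point of the plane is equidistant from three distinct points: two distinct circles
share at most two points. -/
theorem subsingleton_equidistant {x y z : Plane} (hxy : x ≠ y) (hxz : x ≠ z) (hyz : y ≠ z) :
    {q : Plane | dist q x = dist q y ∧ dist q x = dist q z}.Subsingleton := by
  rintro q ⟨hq1, hq2⟩ q' ⟨hq1', hq2'⟩
  by_contra hne
  have h := EuclideanGeometry.eq_of_dist_eq_of_dist_eq_of_finrank_eq_two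
    (V := Plane) (P := Plane) (p := z) (by simp) hne hxy
    (r₁ := dist q x) (r₂ := dist q' x) (dist_comm _ _) (by rw [dist_comm, ← hq1])
    (by rw [dist_comm, ← hq2]) (dist_comm _ _) (by rw [dist_comm, ← hq1'])
    (by rw [dist_comm, ← hq2'])
  exact h.elim (fun h => hxz h.symm) fun h => hyz h.symm

namespace VoronoiGrid

variable {M : ℕ} (G : VoronoiGrid M)

/-! ### The domain, the faces and the control volumes -/

theorem isOpen_domain : IsOpen G.domain := by rw [G.domain_eq]; exact isOpen_interior

theorem convex_domain : Convex ℝ G.domain := by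
  rw [G.domain_eq]; exact (convex_convexHull ℝ _).interior

theorem isBounded_domain : Bornology.IsBounded G.domain := by
  rw [G.domain_eq]
  exact (isBounded_convexHull.2 G.vertices.finite_toSet.isBounded).subset interior_subset

theorem interior_closure_domain : interior (closure G.domain) = G.domain := by
  have h := G.convex_domain.interior_closure_eq_interior_of_nonempty_interior
    (by rw [G.isOpen_domain.interior_eq]; exact G.domain_nonempty)
  rw [h, G.isOpen_domain.interior_eq]

variable {G} in
theorem mem_interiorNodes {i : Fin M} : i ∈ G.interiorNodes ↔ G.node i ∈ G.domain := by
  simp [interiorNodes]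

theorem d_pos {i j : Fin M} (hij : j ≠ i) : 0 < G.d i j :=
  dist_pos.2 fun h => hij (G.node_injective h).symm

theorem d_comm (i j : Fin M) : G.d i j = G.d j i := dist_comm _ _

theorem mid_comm (i j : Fin M) : G.mid i j = G.mid j i := midpoint_comm _ _

theorem face_comm (i j : Fin M) : G.face i j = G.face j i := Set.inter_comm _ _

theorem l_comm (i j : Fin M) : G.l i j = G.l j i := by rw [l, l, face_comm]

theorem l_nonneg (i j : Fin M) : 0 ≤ G.l i j := measureReal_nonneg

/-- The unit normal on the face between `i` and `j`, pointing from `i` to `j`. -/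
noncomputable def normal (i j : Fin M) : Plane := (G.d i j)⁻¹ • (G.node j - G.node i)

theorem norm_normal {i j : Fin M} (hij : j ≠ i) : ‖G.normal i j‖ = 1 := by
  rw [normal, norm_smul, ← dist_eq_norm, dist_comm, norm_inv,
    Real.norm_of_nonneg (G.d_pos hij).le]
  exact inv_mul_cancel₀ (G.d_pos hij).ne'

theorem inner_normal_sub_mid (i j : Fin M) (x : Plane) :
    inner ℝ (G.normal i j) (x - G.mid i j) =
      (dist x (G.node i) ^ 2 - dist x (G.node j) ^ 2) / (2 * G.d i j) := by
  rw [normal, real_inner_smul_left, mid, inner_sub_sub_midpoint]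
  field_simp

theorem inner_normal_neg_iff {i j : Fin M} (hij : j ≠ i) (x : Plane) :
    inner ℝ (G.normal i j) (x - G.mid i j) < 0 ↔ dist x (G.node i) < dist x (G.node j) := by
  have h := G.d_pos hij
  rw [inner_normal_sub_mid, div_lt_iff₀ (by positivity), zero_mul, sub_neg,
    sq_lt_sq₀ dist_nonneg dist_nonneg]

theorem inner_normal_nonpos_iff {i j : Fin M} (hij : j ≠ i) (x : Plane) :
    inner ℝ (G.normal i j) (x - G.mid i j) ≤ 0 ↔ dist x (G.node i) ≤ dist x (G.node j) := by
  have h := G.d_pos hij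
  rw [inner_normal_sub_mid, div_le_iff₀ (by positivity), zero_mul, sub_nonpos,
    sq_le_sq₀ dist_nonneg dist_nonneg]

/-- The signed distance from `p` to the line through the face between `i` and `j`, positive on the
side of the node `i`. -/
noncomputable def height (p : Plane) (i j : Fin M) : ℝ :=
  inner ℝ (G.normal i j) (G.mid i j - p)

theorem inner_normal_sub_mid_eq (i j : Fin M) (p x : Plane) :
    inner ℝ (G.normal i j) (x - G.mid i j) = inner ℝ (G.normal i j) (x - p) - G.height p i j := by
  rw [height, ← inner_sub_right]
  congr 1; abel

theorem height_pos_iff {i j : Fin M} (hij : j ≠ i) (p : Plane) :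
    0 < G.height p i j ↔ dist p (G.node i) < dist p (G.node j) := by
  rw [← G.inner_normal_neg_iff hij, height, ← neg_sub p, inner_neg_right, neg_pos]

theorem inner_normal_eq_height {i j : Fin M} {p q : Plane}
    (hq : dist q (G.node i) = dist q (G.node j)) :
    inner ℝ (G.normal i j) (q - p) = G.height p i j := by
  have h := G.inner_normal_sub_mid i j q
  rw [hq, sub_self, zero_div, G.inner_normal_sub_mid_eq i j p] at h
  linarith

theorem isOpen_voronoiPolygon (i : Fin M) : IsOpen (G.voronoiPolygon i) := by
  have h : G.voronoiPolygon i =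
      ⋂ j, ⋂ (_ : j ≠ i), {x | dist x (G.node i) < dist x (G.node j)} := by
    ext x; simp [voronoiPolygon]
  rw [h]
  refine isOpen_iInter_of_finite fun j => isOpen_iInter_of_finite fun _ => ?_
  exact isOpen_lt (by fun_prop) (by fun_prop)

theorem convex_voronoiPolygon (i : Fin M) : Convex ℝ (G.voronoiPolygon i) := by
  have h : G.voronoiPolygon i =
      ⋂ j, ⋂ (_ : j ≠ i), {x | inner ℝ (G.normal i j) x < inner ℝ (G.normal i j) (G.mid i j)} := by
    ext x
    simp only [voronoiPolygon, Set.mem_ofPred_eq, Set.mem_iInter]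
    refine forall₂_congr fun j hj => ?_
    rw [← G.inner_normal_neg_iff hj, inner_sub_right, sub_neg]
  rw [h]
  exact convex_iInter fun j => convex_iInter fun _ =>
    convex_halfSpace_lt (innerₛₗ ℝ (G.normal i j)).isLinear _

theorem convex_controlVolume (i : Fin M) : Convex ℝ (G.controlVolume i) :=
  (G.convex_voronoiPolygon i).inter G.convex_domain

theorem volume_controlVolume_ne_top (i : Fin M) : volume (G.controlVolume i) ≠ ⊤ :=
  (G.isBounded_domain.subset Set.inter_subset_right).measure_lt_top.ne

theorem node_mem_controlVolume {i : Fin M} (hi : i ∈ G.interiorNodes) :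
    G.node i ∈ G.controlVolume i := by
  refine ⟨fun j hj => ?_, mem_interiorNodes.1 hi⟩
  rw [dist_self]
  exact G.d_pos hj

theorem closure_controlVolume_subset {i j : Fin M} (hij : j ≠ i) :
    closure (G.controlVolume i) ⊆ {x | dist x (G.node i) ≤ dist x (G.node j)} :=
  closure_minimal (fun x hx => (hx.1 j hij).le) (isClosed_le (by fun_prop) (by fun_prop))

theorem dist_eq_of_mem_face {i j : Fin M} (hij : j ≠ i) {q : Plane} (hq : q ∈ G.face i j) :
    dist q (G.node i) = dist q (G.node j) :=
  le_antisymm (G.closure_controlVolume_subset hij (frontier_subset_closure hq.1))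
    (G.closure_controlVolume_subset hij.symm (frontier_subset_closure hq.2))

theorem measurableSet_face (i j : Fin M) : MeasurableSet (G.face i j) :=
  (isClosed_frontier.inter isClosed_frontier).measurableSet

/-! ### Cones over the faces -/

/-- The triangle with apex `p` over the face between `i` and `j`. -/
def faceCone (p : Plane) (i j : Fin M) : Set Plane :=
  coneOver p (G.normal i j) (G.height p i j) (G.face i j)

/-- The cone with apex `p` over the points equidistant from `i`, `j` and `k`. There is at most one
such point, so this is at most a segment; it contains the overlap of the triangles over the faces
`i j` and `i k`. -/
def vertexCone (p : Plane) (i j k : Fin M) : Set Plane :=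
  coneOver p (G.normal i j) (G.height p i j)
    {q | dist q (G.node i) = dist q (G.node j) ∧ dist q (G.node i) = dist q (G.node k)}

theorem volume_faceCone {i j : Fin M} (hij : j ≠ i) {p : Plane} (hp : p ∈ G.voronoiPolygon i) :
    volume (G.faceCone p i j) =
      ENNReal.ofReal (G.height p i j / 2) * Measure.hausdorffMeasure 1 (G.face i j) :=
  volume_coneOver (G.norm_normal hij) ((G.height_pos_iff hij p).2 (hp j hij))
    (G.measurableSet_face i j) fun _ hq => G.inner_normal_eq_height (G.dist_eq_of_mem_face hij hq)

theorem volume_vertexCone {i j k : Fin M} (hij : j ≠ i) (hik : k ≠ i) (hjk : j ≠ k) {p : Plane}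
    (hp : p ∈ G.voronoiPolygon i) : volume (G.vertexCone p i j k) = 0 := by
  have : NullSingletonClass (Measure.hausdorffMeasure 1 : Measure Plane) :=
    Measure.nullSingletonClass_hausdorff _ one_pos
  have hinj := G.node_injective
  rw [vertexCone, volume_coneOver (G.norm_normal hij) ((G.height_pos_iff hij p).2 (hp j hij)) ?_
    fun q hq => G.inner_normal_eq_height hq.1,
    (subsingleton_equidistant (hinj.ne hij.symm) (hinj.ne hik.symm) (hinj.ne hjk)).measure_zero,
    mul_zero]
  exact (subsingleton_equidistant (hinj.ne hij.symm) (hinj.ne hik.symm)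
    (hinj.ne hjk)).measurableSet

theorem faceCone_subset {i : Fin M} (j : Fin M) {p : Plane} (hp : p ∈ G.controlVolume i) :
    G.faceCone p i j ⊆ G.controlVolume i :=
  coneOver_subset_of_convex (G.convex_controlVolume i) (G.controlVolume_isOpen i) hp
    fun _ hq => frontier_subset_closure hq.1

theorem faceCone_inter_subset {i j k : Fin M} (hij : j ≠ i) (hik : k ≠ i) {p : Plane}
    (hp : p ∈ G.controlVolume i) :
    G.faceCone p i j ∩ G.faceCone p i k ⊆ G.vertexCone p i j k := by
  rintro x ⟨hj, hk⟩
  obtain ⟨t, ht, hqt, hte⟩ := exists_ray_param_of_mem_coneOver hj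
  obtain ⟨s, hs, hqs, -⟩ := exists_ray_param_of_mem_coneOver hk
  have hts := eq_of_mem_frontier_of_ray (G.convex_controlVolume i) (G.controlVolume_isOpen i) hp
    (inv_pos.2 ht.1) (inv_pos.2 hs.1) hqt.1 hqs.1
  rw [← hts] at hqs
  refine ⟨hj.1, ?_⟩
  rw [← hte]
  exact ⟨G.dist_eq_of_mem_face hij hqt, G.dist_eq_of_mem_face hik hqs⟩

theorem volume_biUnion_faceCone {i : Fin M} {p : Plane} (hp : p ∈ G.controlVolume i) :
    volume (⋃ j ∈ Finset.univ.erase i, G.faceCone p i j) =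
      ∑ j ∈ Finset.univ.erase i, volume (G.faceCone p i j) := by
  refine measure_biUnion_finset₀ ?_ fun j _ =>
    (measurableSet_coneOver _ _ _ (G.measurableSet_face i j)).nullMeasurableSet
  intro j hj k hk hjk
  have hj' := Finset.ne_of_mem_erase (Finset.mem_coe.1 hj)
  have hk' := Finset.ne_of_mem_erase (Finset.mem_coe.1 hk)
  exact measure_mono_null (G.faceCone_inter_subset hj' hk' hp)
    (G.volume_vertexCone hj' hk' hjk hp.1)

theorem sum_l_mul_height_eq {i : Fin M} {p : Plane} (hp : p ∈ G.controlVolume i) :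
    ∑ j ∈ Finset.univ.erase i, G.l i j * G.height p i j =
      2 * (volume (⋃ j ∈ Finset.univ.erase i, G.faceCone p i j)).toReal := by
  rw [G.volume_biUnion_faceCone hp, ENNReal.toReal_sum, Finset.mul_sum]
  · refine Finset.sum_congr rfl fun j hj => ?_
    have hj' := Finset.ne_of_mem_erase hj
    have hpos := (G.height_pos_iff hj' p).2 (hp.1 j hj')
    rw [G.volume_faceCone hj' hp.1, ENNReal.toReal_mul, ENNReal.toReal_ofReal (by positivity), l,
      Measure.real]
    ring
  · exact fun j _ => measure_ne_top_of_subset (G.faceCone_subset j hp)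
      (G.volume_controlVolume_ne_top i)

/-- The triangles over the faces fit into the control volume. -/
theorem sum_l_mul_height_le {i : Fin M} {p : Plane} (hp : p ∈ G.controlVolume i) :
    ∑ j ∈ Finset.univ.erase i, G.l i j * G.height p i j ≤ 2 * G.V i := by
  rw [G.sum_l_mul_height_eq hp, V, Measure.real]
  gcongr
  · exact G.volume_controlVolume_ne_top i
  · exact Set.iUnion₂_subset fun j _ => G.faceCone_subset j hp

/-! ### Control volumes that are whole Voronoi polygons -/

theorem inner_sub_sub_node_neg {i j : Fin M} (hij : j ≠ i) {q : Plane}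
    (hq : dist q (G.node i) = dist q (G.node j)) :
    inner ℝ (G.node j - G.node i) (q - G.node j) < 0 := by
  have h1 := inner_sub_sub_midpoint (G.node i) (G.node j) q
  rw [hq, sub_self, zero_div] at h1
  have h2 : q - G.node j =
      (q - midpoint ℝ (G.node i) (G.node j)) - (2 : ℝ)⁻¹ • (G.node j - G.node i) := by
    rw [midpoint_eq_smul_add, invOf_eq_inv]
    module
  have h3 : 0 < ‖G.node j - G.node i‖ :=
    norm_pos_iff.2 (sub_ne_zero.2 (G.node_injective.ne hij))
  rw [h2, inner_sub_right, h1, real_inner_smul_right, real_inner_self_eq_norm_sq]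
  nlinarith

/-- From a point on the bisector of `i` and `j` that is farther from all the other nodes, each
direction pointing to the side of `i` leads into the Voronoi polygon of `i`. -/
theorem eventually_mem_voronoiPolygon {i j : Fin M} {q u : Plane}
    (hq : dist q (G.node i) = dist q (G.node j))
    (hlt : ∀ k, k ≠ i → k ≠ j → dist q (G.node i) < dist q (G.node k))
    (hu : inner ℝ (G.node j - G.node i) u < 0) :
    ∀ᶠ ε in 𝓝[>] (0 : ℝ), q + ε • u ∈ G.voronoiPolygon i := by
  simp only [voronoiPolygon, Set.mem_ofPred_eq]
  rw [eventually_all]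
  intro k
  by_cases hki : k = i
  · exact .of_forall fun ε h => absurd hki h
  by_cases hkj : k = j
  · subst hkj
    filter_upwards [self_mem_nhdsWithin] with ε (hε : 0 < ε) _
    rw [← G.inner_normal_neg_iff hki, normal, real_inner_smul_left]
    refine mul_neg_of_pos_of_neg (inv_pos.2 (G.d_pos hki)) ?_
    have h1 := inner_sub_sub_midpoint (G.node i) (G.node k) q
    rw [hq, sub_self, zero_div] at h1
    rw [mid, add_sub_right_comm, inner_add_right, h1, zero_add, real_inner_smul_right]
    exact mul_neg_of_pos_of_neg hε hu
  · have h1 : ContinuousAt (fun ε : ℝ => dist (q + ε • u) (G.node i)) 0 := by fun_prop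
    have h2 : ContinuousAt (fun ε : ℝ => dist (q + ε • u) (G.node k)) 0 := by fun_prop
    have h3 := h1.eventually_lt h2 (by simpa using hlt k hki hkj)
    filter_upwards [nhdsWithin_le_nhds h3] with ε hε _ using hε

/-- The edges of a Voronoi polygon in the closed polygon are faces: a point of the bisector of `i`
and `j` that is nearest to these two nodes only cannot lie on `∂Ω`, since points slightly farther away
from the node `j` belong to `P_i`. -/
theorem mem_face_of_dist_eq {i j : Fin M} (hij : j ≠ i)
    (hi : G.voronoiPolygon i ⊆ closure G.domain) {q : Plane}
    (hq : dist q (G.node i) = dist q (G.node j))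
    (hlt : ∀ k, k ≠ i → k ≠ j → dist q (G.node i) < dist q (G.node k)) :
    q ∈ G.face i j := by
  have hPi : G.voronoiPolygon i ⊆ G.domain := by
    rw [← G.interior_closure_domain]
    exact interior_maximal hi (G.isOpen_voronoiPolygon i)
  have hneg := G.inner_sub_sub_node_neg hij hq
  have hi' := G.eventually_mem_voronoiPolygon hq hlt hneg
  have hj' := G.eventually_mem_voronoiPolygon (i := j) (j := i) (u := G.node j - q) hq.symm
    (fun k hkj hki => hq ▸ hlt k hki hkj) (by
      rw [← neg_sub (G.node j) (G.node i), ← neg_sub q (G.node j), inner_neg_neg]; exact hneg)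
  -- `q` lies between the node `j` and a point of the Voronoi polygon of `i`, hence inside
  have hqΩ : q ∈ G.domain := by
    obtain ⟨ε, hε, h0⟩ := (hi'.and self_mem_nhdsWithin).exists
    have h0 : 0 < ε := h0
    have h1 := G.convex_domain.openSegment_interior_closure_subset_interior
      (by rw [G.isOpen_domain.interior_eq]; exact hPi hε) (G.node_mem j)
    rw [G.isOpen_domain.interior_eq] at h1
    refine h1 ⟨1 / (1 + ε), ε / (1 + ε), by positivity, by positivity, by field_simp, ?_⟩
    match_scalars <;> field_simp
    ring
  have hlim : ∀ u : Plane, Tendsto (fun ε : ℝ => q + ε • u) (𝓝[>] 0) (𝓝 q) := fun u => by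
    have h : ContinuousAt (fun ε : ℝ => q + ε • u) 0 := by fun_prop
    have h' := h.tendsto
    simp only [zero_smul, add_zero] at h'
    exact h'.mono_left nhdsWithin_le_nhds
  have hΩ : ∀ u : Plane, ∀ᶠ ε in 𝓝[>] (0 : ℝ), q + ε • u ∈ G.domain := fun u =>
    hlim u (G.isOpen_domain.mem_nhds hqΩ)
  constructor
  · rw [(G.controlVolume_isOpen i).frontier_eq]
    exact ⟨mem_closure_of_tendsto (hlim _) (hi'.and (hΩ _)), fun h => (h.1 j hij).ne hq⟩
  · rw [(G.controlVolume_isOpen j).frontier_eq]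
    exact ⟨mem_closure_of_tendsto (hlim _) (hj'.and (hΩ _)), fun h => (h.1 i hij.symm).ne hq.symm⟩

/-- A ray from a point of a bounded Voronoi polygon hits one of the bisectors first. -/
theorem exists_first_bisector {i : Fin M} (hb : Bornology.IsBounded (G.voronoiPolygon i))
    {p x : Plane} (hp : p ∈ G.voronoiPolygon i) (hx : x ∈ G.voronoiPolygon i) (hxp : x ≠ p) :
    ∃ j ≠ i, inner ℝ (G.normal i j) (x - p) ∈ Set.Ioo 0 (G.height p i j) ∧
      ∀ k ≠ i, dist (p + (G.height p i j / inner ℝ (G.normal i j) (x - p)) • (x - p)) (G.node i) ≤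
        dist (p + (G.height p i j / inner ℝ (G.normal i j) (x - p)) • (x - p)) (G.node k) := by
  have hh : ∀ j ≠ i, 0 < G.height p i j := fun j hj => (G.height_pos_iff hj p).2 (hp j hj)
  -- `s j` is the reciprocal of the time at which the ray hits the bisector of `i` and `j`
  set s : Fin M → ℝ := fun j => inner ℝ (G.normal i j) (x - p) / G.height p i j with hs
  have hex : ∃ j ≠ i, 0 < s j := by
    by_contra! hcon
    have hray : ∀ t : ℝ, 0 ≤ t → p + t • (x - p) ∈ G.voronoiPolygon i := by
      intro t ht j hj
      rw [← G.inner_normal_neg_iff hj, G.inner_normal_sub_mid_eq i j p, add_sub_cancel_left,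
        real_inner_smul_right]
      have h1 := hcon j hj
      rw [hs, div_le_iff₀ (hh j hj), zero_mul] at h1
      nlinarith [hh j hj]
    obtain ⟨R, hR⟩ := hb.subset_closedBall p
    have hn : 0 < ‖x - p‖ := norm_pos_iff.2 (sub_ne_zero.2 hxp)
    have h1 := hR (hray ((|R| + 1) / ‖x - p‖) (by positivity))
    rw [Metric.mem_closedBall, dist_eq_norm, add_sub_cancel_left, norm_smul,
      Real.norm_of_nonneg (by positivity), div_mul_cancel₀ _ hn.ne'] at h1
    linarith [le_abs_self R]
  obtain ⟨j₀, hj₀, hpos₀⟩ := hex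
  obtain ⟨j, hj, hmax⟩ := (Finset.univ.erase i).exists_max_image s
    ⟨j₀, Finset.mem_erase.2 ⟨hj₀, Finset.mem_univ _⟩⟩
  have hji := Finset.ne_of_mem_erase hj
  have hpos : 0 < s j := hpos₀.trans_le (hmax j₀ (Finset.mem_erase.2 ⟨hj₀, Finset.mem_univ _⟩))
  have hinner : ∀ k ≠ i, inner ℝ (G.normal i k) (x - p) = s k * G.height p i k := fun k hk =>
    (div_mul_cancel₀ _ (hh k hk).ne').symm
  refine ⟨j, hji, ⟨?_, ?_⟩, fun k hk => ?_⟩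
  · rw [hinner j hji]; exact mul_pos hpos (hh j hji)
  · have h1 := (G.inner_normal_neg_iff hji x).2 (hx j hji)
    rw [G.inner_normal_sub_mid_eq i j p] at h1
    linarith
  · have h1 : G.height p i j / inner ℝ (G.normal i j) (x - p) = (s j)⁻¹ := (inv_div _ _).symm
    rw [← G.inner_normal_nonpos_iff hk, G.inner_normal_sub_mid_eq i k p, add_sub_cancel_left,
      real_inner_smul_right, h1, hinner k hk, ← mul_assoc, sub_nonpos]
    have h2 : (s j)⁻¹ * s k ≤ 1 := by
      rw [inv_mul_le_iff₀ hpos, mul_one]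
      exact hmax k (Finset.mem_erase.2 ⟨hk, Finset.mem_univ _⟩)
    nlinarith [hh k hk]

/-- The triangles over the faces cover the Voronoi polygon up to the apex and the segments from the
apex to the vertices. -/
theorem voronoiPolygon_subset_cones {i : Fin M} (hi : G.voronoiPolygon i ⊆ closure G.domain)
    {p : Plane} (hp : p ∈ G.voronoiPolygon i) :
    G.voronoiPolygon i ⊆ ({p} ∪ ⋃ j ∈ {j | j ≠ i}, ⋃ k ∈ {k | k ≠ i ∧ j ≠ k},
      G.vertexCone p i j k) ∪ ⋃ j ∈ Finset.univ.erase i, G.faceCone p i j := by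
  intro x hx
  by_cases hxp : x = p
  · exact Or.inl (Or.inl hxp)
  obtain ⟨j, hj, hin, hle⟩ :=
    G.exists_first_bisector (G.isBounded_domain.closure.subset hi) hp hx hxp
  set q := p + (G.height p i j / inner ℝ (G.normal i j) (x - p)) • (x - p) with hq
  have hqj : dist q (G.node i) = dist q (G.node j) := by
    have h := G.inner_normal_sub_mid i j q
    rw [G.inner_normal_sub_mid_eq i j p, hq, add_sub_cancel_left, real_inner_smul_right,
      div_mul_cancel₀ _ hin.1.ne', sub_self, ← hq, eq_comm, div_eq_zero_iff] at h
    have h2 := G.d_pos hj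
    exact (sq_eq_sq₀ dist_nonneg dist_nonneg).1
      (sub_eq_zero.1 (h.resolve_right (by positivity)))
  by_cases hk : ∃ k, k ≠ i ∧ j ≠ k ∧ dist q (G.node i) = dist q (G.node k)
  · obtain ⟨k, hki, hjk, hqk⟩ := hk
    exact Or.inl (Or.inr (Set.mem_biUnion hj (Set.mem_biUnion (⟨hki, hjk⟩ : _ ∧ _)
      ⟨hin, hqj, hqk⟩)))
  · refine Or.inr (Set.mem_biUnion (Finset.mem_erase.2 ⟨hj, Finset.mem_univ j⟩) ⟨hin, ?_⟩)
    refine G.mem_face_of_dist_eq hj hi hqj fun k hki hkj => ?_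
    exact (hle k hki).lt_of_ne fun h => hk ⟨k, hki, hkj.symm, h⟩

theorem sum_l_mul_height_eq_of_mem {i : Fin M} (hi : G.voronoiPolygon i ⊆ closure G.domain)
    {p : Plane} (hp : p ∈ G.controlVolume i) :
    ∑ j ∈ Finset.univ.erase i, G.l i j * G.height p i j = 2 * G.V i := by
  refine le_antisymm (G.sum_l_mul_height_le hp) ?_
  have hnull : volume ({p} ∪ ⋃ j ∈ {j | j ≠ i}, ⋃ k ∈ {k | k ≠ i ∧ j ≠ k},
      G.vertexCone p i j k) = 0 := by
    refine measure_union_null (measure_singleton p) ?_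
    refine (measure_biUnion_null_iff (Set.to_countable _)).2 fun j hj => ?_
    refine (measure_biUnion_null_iff (Set.to_countable _)).2 fun k hk => ?_
    exact G.volume_vertexCone hj hk.1 hk.2 hp.1
  rw [G.sum_l_mul_height_eq hp, V, Measure.real]
  refine mul_le_mul_of_nonneg_left (ENNReal.toReal_mono ?_ ?_) zero_le_two
  · exact measure_ne_top_of_subset (Set.iUnion₂_subset fun j _ => G.faceCone_subset j hp)
      (G.volume_controlVolume_ne_top i)
  · calc volume (G.controlVolume i)
        ≤ volume (_ ∪ _) := measure_mono
          (Set.inter_subset_left.trans (G.voronoiPolygon_subset_cones hi hp.1))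
      _ ≤ _ := measure_union_le _ _
      _ = _ := by rw [hnull, zero_add]

/-- Divergence theorem for the field `x ↦ x - c` on a control volume that is a whole Voronoi
polygon. The point `c` is arbitrary: both sides are affine in it and agree on the open control
volume. -/
theorem sum_l_mul_height_eq_two_mul_V {i : Fin M} (hmem : i ∈ G.interiorNodes)
    (hi : G.voronoiPolygon i ⊆ closure G.domain) (c : Plane) :
    ∑ j ∈ Finset.univ.erase i, G.l i j * G.height c i j = 2 * G.V i := by
  have hx := G.node_mem_controlVolume hmem
  have hc : ContinuousAt (fun ε : ℝ => G.node i + ε • (c - G.node i)) 0 := by fun_prop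
  have hev : ∀ᶠ ε in 𝓝[>] (0 : ℝ), G.node i + ε • (c - G.node i) ∈ G.controlVolume i :=
    nhdsWithin_le_nhds (hc ((G.controlVolume_isOpen i).mem_nhds (by simpa using hx)))
  obtain ⟨ε, hε, h0⟩ := (hev.and self_mem_nhdsWithin).exists
  have h0 : 0 < ε := h0
  have h1 := G.sum_l_mul_height_eq_of_mem hi hx
  have h2 := G.sum_l_mul_height_eq_of_mem hi hε
  have h3 : ∀ j, G.height (G.node i + ε • (c - G.node i)) i j =
      (1 - ε) * G.height (G.node i) i j + ε * G.height c i j := fun j => by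
    simp only [height, inner_sub_right, inner_add_right, real_inner_smul_right]
    ring
  have h4 : (1 - ε) * (2 * G.V i) + ε * ∑ j ∈ Finset.univ.erase i, G.l i j * G.height c i j =
      ∑ j ∈ Finset.univ.erase i, G.l i j * G.height (G.node i + ε • (c - G.node i)) i j := by
    rw [← h1, Finset.mul_sum, Finset.mul_sum, ← Finset.sum_add_distrib]
    refine Finset.sum_congr rfl fun j _ => ?_
    rw [h3]; ring
  exact mul_left_cancel₀ h0.ne' (by linarith)

end VoronoiGrid

/-! ### Summation by parts -/

/-- Picone's inequality on a pair of nodes. -/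
theorem picone_inequality {x z f g : ℝ} (hf : 0 < f) (hg : 0 < g) :
    (f - g) * (x ^ 2 / f - z ^ 2 / g) ≤ (z - x) ^ 2 := by
  have h : (z - x) ^ 2 - (f - g) * (x ^ 2 / f - z ^ 2 / g) = (f * z - g * x) ^ 2 / (f * g) := by
    field_simp
    ring
  have h' : 0 ≤ (f * z - g * x) ^ 2 / (f * g) := by positivity
  linarith

theorem sum_sum_mul_eq_zero_of_antisymm {ι : Type*} [Fintype ι] {a S : ι → ι → ℝ}
    (ha : ∀ i j, a i j = -a j i) (hS : ∀ i j, S i j = S j i) : ∑ i, ∑ j, a i j * S i j = 0 := by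
  have h : ∑ i, ∑ j, a i j * S i j = -∑ i, ∑ j, a i j * S i j := by
    conv_lhs => rw [Finset.sum_comm]
    simp only [← Finset.sum_neg_distrib]
    exact Finset.sum_congr rfl fun i _ => Finset.sum_congr rfl fun j _ => by
      rw [ha j i, hS j i, neg_mul]
  linarith

/-- Summation by parts. -/
theorem sum_mul_sum_mul_sub {ι : Type*} [Fintype ι] {w : ι → ι → ℝ} (hw : ∀ i j, w i j = w j i)
    (f g : ι → ℝ) :
    ∑ i, (∑ j, w i j * (f i - f j)) * g i =
      1 / 2 * ∑ i, ∑ j, w i j * ((f i - f j) * (g i - g j)) := by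
  have h := sum_sum_mul_eq_zero_of_antisymm (a := fun i j => w i j * (f i - f j))
    (S := fun i j => (g i + g j) / 2) (fun i j => by rw [hw i j]; ring) (fun i j => by ring)
  rw [Finset.mul_sum, ← sub_eq_zero, ← Finset.sum_sub_distrib, ← h]
  refine Finset.sum_congr rfl fun i _ => ?_
  rw [Finset.sum_mul, Finset.mul_sum, ← Finset.sum_sub_distrib]
  exact Finset.sum_congr rfl fun j _ => by ring

namespace VoronoiGrid

variable {M : ℕ} (G : VoronoiGrid M)

/-! ### Sums over the faces -/

theorem b_antisymm (v : Plane → Plane) (i j : Fin M) : G.b v i j = -G.b v j i := by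
  rw [b, b, G.mid_comm j i, G.d_comm j i, ← inner_neg_right, ← smul_neg, neg_sub]

theorem b_self (v : Plane → Plane) (i : Fin M) : G.b v i i = 0 := by simp [b]

theorem l_mul_b_antisymm (v : Plane → Plane) (i j : Fin M) :
    G.l i j * G.b v i j = -(G.l j i * G.b v j i) := by
  rw [G.l_comm, G.b_antisymm, mul_neg]

theorem sum_neighbors_eq (i : Fin M) {f : Fin M → ℝ} (hf : f i = 0) :
    ∑ j ∈ G.neighbors i, G.l i j * f j = ∑ j, G.l i j * f j := by
  refine Finset.sum_subset (Finset.subset_univ _) fun j _ hj => ?_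
  simp only [neighbors, Finset.mem_filter, Finset.mem_univ, true_and, not_and, not_lt] at hj
  by_cases hji : j = i
  · rw [hji, hf, mul_zero]
  · rw [le_antisymm (hj hji) (G.l_nonneg i j), zero_mul]

theorem sum_neighbors_l_mul_b (v : Plane → Plane) (i : Fin M) (f : Fin M → ℝ) :
    ∑ j ∈ G.neighbors i, G.l i j * G.b v i j * f j = ∑ j, G.l i j * G.b v i j * f j := by
  simp_rw [mul_assoc]
  exact G.sum_neighbors_eq i (f := fun j => G.b v i j * f j) (by simp [G.b_self])

theorem inner_eq_sum {A w : G.H} {F : Fin M → ℝ} (h : ∀ i ∈ G.interiorNodes, G.V i * A i = F i) :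
    inner ℝ A w = ∑ i, F i * w i := by
  rw [G.inner_eq, ← Finset.sum_subset (Finset.subset_univ G.interiorNodes)]
  · exact Finset.sum_congr rfl fun i hi => by rw [h i hi]
  · exact fun i _ hi => by rw [w.2 i hi, mul_zero]

theorem norm_sq_eq (y : G.H) : ‖y‖ ^ 2 = ∑ i ∈ G.interiorNodes, G.V i * y i ^ 2 := by
  rw [← real_inner_self_eq_norm_sq, G.inner_eq]
  exact Finset.sum_congr rfl fun i _ => by ring

/-! ### Adjoints and energy estimates -/

theorem V_mul_C₁ (v : Plane → Plane) (y : G.H) {i : Fin M} (hi : i ∈ G.interiorNodes) :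
    G.V i * G.C₁ v y i = ∑ j, G.l i j * G.b v i j * ((y j - y i) / 2) := by
  have h : G.C₁ v y i =
      1 / G.V i * ∑ j ∈ G.neighbors i, G.l i j * G.b v i j * ((y j - y i) / 2) := if_pos hi
  rw [h, ← mul_assoc, mul_one_div_cancel (G.V_pos hi).ne', one_mul, G.sum_neighbors_l_mul_b]

theorem V_mul_C₂ (v : Plane → Plane) (y : G.H) {i : Fin M} (hi : i ∈ G.interiorNodes) :
    G.V i * G.C₂ v y i = ∑ j, G.l i j * G.b v i j * ((y j + y i) / 2) := by
  have h : G.C₂ v y i =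
      1 / G.V i * ∑ j ∈ G.neighbors i, G.l i j * G.b v i j * ((y j + y i) / 2) := if_pos hi
  rw [h, ← mul_assoc, mul_one_div_cancel (G.V_pos hi).ne', one_mul, G.sum_neighbors_l_mul_b]

theorem V_mul_C₀ (v : Plane → Plane) (y : G.H) {i : Fin M} (hi : i ∈ G.interiorNodes) :
    G.V i * G.C₀ v y i = ∑ j, G.l i j * G.b v i j * (y j / 2) := by
  have h : G.C₀ v y i =
      1 / (2 * G.V i) * ∑ j ∈ G.neighbors i, G.l i j * G.b v i j * y j := if_pos hi
  have hV := (G.V_pos hi).ne'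
  rw [h, G.sum_neighbors_l_mul_b, ← mul_assoc, Finset.mul_sum]
  exact Finset.sum_congr rfl fun j _ => by field_simp

theorem V_mul_divh (v : Plane → Plane) {i : Fin M} (hi : i ∈ G.interiorNodes) :
    G.V i * G.divh v i = ∑ j, G.l i j * G.b v i j := by
  have h := G.sum_neighbors_l_mul_b v i fun _ => 1
  simp only [mul_one] at h
  rw [divh, ← mul_assoc, mul_one_div_cancel (G.V_pos hi).ne', one_mul, h]

theorem C₂_apply_eq (v : Plane → Plane) (y : G.H) {i : Fin M} (hi : i ∈ G.interiorNodes) :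
    G.C₂ v y i = G.C₁ v y i + G.divh v i * y i := by
  refine mul_left_cancel₀ (G.V_pos hi).ne' ?_
  rw [mul_add, ← mul_assoc, G.V_mul_C₂ v y hi, G.V_mul_C₁ v y hi, G.V_mul_divh v hi,
    Finset.sum_mul, ← Finset.sum_add_distrib]
  exact Finset.sum_congr rfl fun j _ => by ring

theorem C₀_apply_eq (v : Plane → Plane) (y : G.H) {i : Fin M} (hi : i ∈ G.interiorNodes) :
    G.C₀ v y i = G.C₁ v y i + 1 / 2 * (G.divh v i * y i) := by
  refine mul_left_cancel₀ (G.V_pos hi).ne' ?_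
  rw [mul_add, mul_left_comm, ← mul_assoc (G.V i), G.V_mul_C₀ v y hi, G.V_mul_C₁ v y hi,
    G.V_mul_divh v hi, Finset.sum_mul, Finset.mul_sum, ← Finset.sum_add_distrib]
  exact Finset.sum_congr rfl fun j _ => by ring

theorem inner_C₂_add_inner_C₁ (v : Plane → Plane) (x y : G.H) :
    inner ℝ (G.C₂ v x) y + inner ℝ x (G.C₁ v y) = 0 := by
  rw [real_inner_comm (G.C₁ v y) x, G.inner_eq_sum fun i hi => G.V_mul_C₂ v x hi,
    G.inner_eq_sum fun i hi => G.V_mul_C₁ v y hi, ← Finset.sum_add_distrib,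
    ← sum_sum_mul_eq_zero_of_antisymm (G.l_mul_b_antisymm v)
      (S := fun i j => (x j * y i + y j * x i) / 2) fun i j => by ring]
  refine Finset.sum_congr rfl fun i _ => ?_
  rw [Finset.sum_mul, Finset.sum_mul, ← Finset.sum_add_distrib]
  exact Finset.sum_congr rfl fun j _ => by ring

theorem inner_C₀_add_inner_C₀ (v : Plane → Plane) (x y : G.H) :
    inner ℝ (G.C₀ v x) y + inner ℝ x (G.C₀ v y) = 0 := by
  rw [real_inner_comm (G.C₀ v y) x, G.inner_eq_sum fun i hi => G.V_mul_C₀ v x hi,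
    G.inner_eq_sum fun i hi => G.V_mul_C₀ v y hi, ← Finset.sum_add_distrib,
    ← sum_sum_mul_eq_zero_of_antisymm (G.l_mul_b_antisymm v)
      (S := fun i j => (x j * y i + y j * x i) / 2) fun i j => by ring]
  refine Finset.sum_congr rfl fun i _ => ?_
  rw [Finset.sum_mul, Finset.sum_mul, ← Finset.sum_add_distrib]
  exact Finset.sum_congr rfl fun j _ => by ring

theorem adjoint_C₁ (v : Plane → Plane) : LinearMap.adjoint (G.C₁ v) = -G.C₂ v := by
  refine ((LinearMap.eq_adjoint_iff _ _).2 fun x y => ?_).symm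
  rw [LinearMap.neg_apply, inner_neg_left]
  linarith [G.inner_C₂_add_inner_C₁ v x y]

theorem adjoint_C₀ (v : Plane → Plane) : LinearMap.adjoint (G.C₀ v) = -G.C₀ v := by
  refine ((LinearMap.eq_adjoint_iff _ _).2 fun x y => ?_).symm
  rw [LinearMap.neg_apply, inner_neg_left]
  linarith [G.inner_C₀_add_inner_C₀ v x y]

theorem abs_divh_le (v : Plane → Plane) {i : Fin M} (hi : i ∈ G.interiorNodes) :
    |G.divh v i| ≤ G.divhNorm v :=
  le_ciSup (f := fun i : G.interiorNodes => |G.divh v i|) (Set.finite_range _).bddAbove ⟨i, hi⟩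

theorem b_sq_le (v : Plane → Plane) {i j : Fin M} (hi : i ∈ G.interiorNodes)
    (hj : j ∈ G.neighbors i) : G.b v i j ^ 2 ≤ G.bMaxSq v := by
  rw [← sq_abs]
  exact (le_ciSup (f := fun j : G.neighbors i => |G.b v i j| ^ 2)
    (Set.finite_range _).bddAbove ⟨j, hj⟩).trans
    (le_ciSup (f := fun i : G.interiorNodes => ⨆ j : G.neighbors i, |G.b v i j| ^ 2)
      (Set.finite_range _).bddAbove ⟨i, hi⟩)

theorem bMaxSq_nonneg (v : Plane → Plane) : 0 ≤ G.bMaxSq v :=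
  Real.iSup_nonneg fun _ => Real.iSup_nonneg fun _ => by positivity

theorem inner_C₂_sub_inner_C₁ (v : Plane → Plane) (y : G.H) :
    inner ℝ (G.C₂ v y) y - inner ℝ (G.C₁ v y) y =
      ∑ i ∈ G.interiorNodes, G.V i * G.divh v i * y i ^ 2 := by
  rw [G.inner_eq, G.inner_eq, ← Finset.sum_sub_distrib]
  exact Finset.sum_congr rfl fun i hi => by rw [G.C₂_apply_eq v y hi]; ring

theorem abs_sum_divh_le (v : Plane → Plane) (y : G.H) :
    |∑ i ∈ G.interiorNodes, G.V i * G.divh v i * y i ^ 2| ≤ G.divhNorm v * ‖y‖ ^ 2 := by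
  rw [G.norm_sq_eq, Finset.mul_sum]
  refine (Finset.abs_sum_le_sum_abs _ _).trans (Finset.sum_le_sum fun i hi => ?_)
  have hV := G.V_pos hi
  rw [abs_mul, abs_mul, abs_of_pos hV, abs_of_nonneg (sq_nonneg (y i))]
  nlinarith [mul_le_mul_of_nonneg_left (G.abs_divh_le v hi) (by positivity : 0 ≤ G.V i * y i ^ 2)]

theorem abs_inner_C₁_le (v : Plane → Plane) (y : G.H) :
    |inner ℝ (G.C₁ v y) y| ≤ 1 / 2 * G.divhNorm v * ‖y‖ ^ 2 := by
  have h1 := G.inner_C₂_add_inner_C₁ v y y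
  have h2 := G.inner_C₂_sub_inner_C₁ v y
  have h3 := abs_le.1 (G.abs_sum_divh_le v y)
  rw [real_inner_comm (G.C₁ v y) y] at h1
  rw [abs_le]
  constructor <;> linarith [h3.1, h3.2]

theorem abs_inner_C₂_le (v : Plane → Plane) (y : G.H) :
    |inner ℝ (G.C₂ v y) y| ≤ 1 / 2 * G.divhNorm v * ‖y‖ ^ 2 := by
  have h1 := G.inner_C₂_add_inner_C₁ v y y
  have h2 := G.inner_C₂_sub_inner_C₁ v y
  have h3 := abs_le.1 (G.abs_sum_divh_le v y)
  rw [real_inner_comm (G.C₁ v y) y] at h1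
  rw [abs_le]
  constructor <;> linarith [h3.1, h3.2]

/-! ### The discrete Dirichlet energy -/

/-- The transmissibility `l_ij / d_ij` of a face; it is `0` for `i = j`, where `d_ij = 0`. -/
noncomputable def transmissibility (i j : Fin M) : ℝ := G.l i j / G.d i j

/-- The discrete Dirichlet integral of a grid function; the sum is over ordered pairs, so that each
face counts twice. -/
noncomputable def energy (y : Fin M → ℝ) : ℝ := ∑ i, ∑ j, G.transmissibility i j * (y j - y i) ^ 2

theorem transmissibility_comm (i j : Fin M) : G.transmissibility i j = G.transmissibility j i := by
  rw [transmissibility, transmissibility, l_comm, d_comm]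

theorem transmissibility_nonneg (i j : Fin M) : 0 ≤ G.transmissibility i j :=
  div_nonneg (G.l_nonneg i j) dist_nonneg

theorem energy_nonneg (y : Fin M → ℝ) : 0 ≤ G.energy y :=
  Finset.sum_nonneg fun i _ => Finset.sum_nonneg fun j _ =>
    mul_nonneg (G.transmissibility_nonneg i j) (sq_nonneg _)

theorem mid_mem_domain {i : Fin M} (hi : i ∈ G.interiorNodes) (j : Fin M) :
    G.mid i j ∈ G.domain := by
  have h := G.convex_domain.openSegment_interior_closure_subset_interior
    (by rw [G.isOpen_domain.interior_eq]; exact mem_interiorNodes.1 hi) (G.node_mem j)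
  rw [G.isOpen_domain.interior_eq] at h
  refine h ⟨1 / 2, 1 / 2, by norm_num, by norm_num, by norm_num, ?_⟩
  rw [mid, midpoint_eq_smul_add, invOf_eq_inv, smul_add, one_div]

theorem V_mul_D (k : Plane → ℝ) (y : G.H) {i : Fin M} (hi : i ∈ G.interiorNodes) :
    G.V i * G.D k y i = ∑ j, G.transmissibility i j * k (G.mid i j) * (y i - y j) := by
  have h : G.D k y i = -(1 / G.V i * ∑ j ∈ G.neighbors i,
      G.l i j * k (G.mid i j) * ((y j - y i) / G.d i j)) := if_pos hi
  simp_rw [mul_assoc] at h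
  rw [G.sum_neighbors_eq i (by simp)] at h
  rw [h, mul_neg, ← mul_assoc, mul_one_div_cancel (G.V_pos hi).ne', one_mul,
    ← Finset.sum_neg_distrib]
  exact Finset.sum_congr rfl fun j _ => by rw [transmissibility]; ring

theorem energy_le_inner_D {k : Plane → ℝ} {κ : ℝ} (hκ : ∀ x ∈ G.domain, κ ≤ k x) (y : G.H) :
    κ / 2 * G.energy y ≤ inner ℝ (G.D k y) y := by
  rw [G.inner_eq_sum fun i hi => G.V_mul_D k y hi,
    sum_mul_sum_mul_sub (w := fun i j => G.transmissibility i j * k (G.mid i j))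
      (fun i j => by rw [G.transmissibility_comm, G.mid_comm]) y y]
  suffices hsum : κ * G.energy y ≤
      ∑ i, ∑ j, G.transmissibility i j * k (G.mid i j) * ((y i - y j) * (y i - y j)) by linarith
  simp_rw [energy, Finset.mul_sum]
  refine Finset.sum_le_sum fun i _ => Finset.sum_le_sum fun j _ => ?_
  have h : G.transmissibility i j * (y i - y j) ^ 2 * κ ≤
      G.transmissibility i j * (y i - y j) ^ 2 * k (G.mid i j) := by
    have hnn : 0 ≤ G.transmissibility i j * (y i - y j) ^ 2 :=
      mul_nonneg (G.transmissibility_nonneg i j) (sq_nonneg _)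
    by_cases hi : i ∈ G.interiorNodes
    · exact mul_le_mul_of_nonneg_left (hκ _ (G.mid_mem_domain hi j)) hnn
    by_cases hj : j ∈ G.interiorNodes
    · rw [G.mid_comm]
      exact mul_le_mul_of_nonneg_left (hκ _ (G.mid_mem_domain hj i)) hnn
    -- the coefficient is not controlled on faces between boundary nodes, but there `y` vanishes
    · rw [y.2 i hi, y.2 j hj]; simp
  linarith

theorem sum_l_mul_d_le {i : Fin M} (hi : i ∈ G.interiorNodes) :
    ∑ j ∈ G.neighbors i, G.l i j * G.d i j ≤ 4 * G.V i := by
  have h := G.sum_l_mul_height_le (G.node_mem_controlVolume hi)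
  have hsub : G.neighbors i ⊆ Finset.univ.erase i := fun j hj =>
    Finset.mem_erase.2 ⟨(Finset.mem_filter.1 hj).2.1, Finset.mem_univ j⟩
  have hheight : ∀ j ∈ Finset.univ.erase i, G.height (G.node i) i j = G.d i j / 2 := by
    intro j hj
    have hd := (G.d_pos (Finset.ne_of_mem_erase hj)).ne'
    have h1 := G.inner_normal_sub_mid i j (G.node i)
    rw [G.inner_normal_sub_mid_eq i j (G.node i), sub_self, inner_zero_right, dist_self] at h1
    change _ = (0 ^ 2 - G.d i j ^ 2) / (2 * G.d i j) at h1
    field_simp at h1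
    exact mul_right_cancel₀ hd (by linarith)
  calc ∑ j ∈ G.neighbors i, G.l i j * G.d i j
      ≤ ∑ j ∈ Finset.univ.erase i, G.l i j * G.d i j :=
        Finset.sum_le_sum_of_subset_of_nonneg hsub fun j _ _ =>
          mul_nonneg (G.l_nonneg i j) dist_nonneg
    _ = 2 * ∑ j ∈ Finset.univ.erase i, G.l i j * G.height (G.node i) i j := by
        rw [Finset.mul_sum]
        exact Finset.sum_congr rfl fun j hj => by rw [hheight j hj]; ring
    _ ≤ 4 * G.V i := by linarith

/-- Cauchy's inequality with the weights `l_ij d_ij` and `l_ij / d_ij`. -/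
theorem norm_C₁_sq_le (v : Plane → Plane) (y : G.H) :
    ‖G.C₁ v y‖ ^ 2 ≤ G.bMaxSq v * G.energy y := by
  have hB := G.bMaxSq_nonneg v
  have hnn : ∀ i, 0 ≤ ∑ j, G.transmissibility i j * (y j - y i) ^ 2 := fun i =>
    Finset.sum_nonneg fun j _ => mul_nonneg (G.transmissibility_nonneg i j) (sq_nonneg _)
  rw [G.norm_sq_eq, energy, Finset.mul_sum]
  refine (Finset.sum_le_sum fun i hi => ?_).trans (Finset.sum_le_sum_of_subset_of_nonneg
    (Finset.subset_univ G.interiorNodes) fun i _ _ => mul_nonneg hB (hnn i))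
  have hV := G.V_pos hi
  have hd : ∀ j ∈ G.neighbors i, 0 < G.d i j := fun j hj => G.d_pos (Finset.mem_filter.1 hj).2.1
  have hCS := Finset.sum_sq_le_sum_mul_sum_of_sq_le_mul (G.neighbors i)
    (r := fun j => G.l i j * G.b v i j * ((y j - y i) / 2))
    (f := fun j => G.l i j * G.d i j * G.b v i j ^ 2)
    (g := fun j => G.transmissibility i j * (y j - y i) ^ 2 / 4)
    (fun j hj => mul_nonneg (mul_nonneg (G.l_nonneg i j) (hd j hj).le) (sq_nonneg _))
    (fun j _ => div_nonneg (mul_nonneg (G.transmissibility_nonneg i j) (sq_nonneg _)) zero_le_four)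
    (fun j hj => by have := (hd j hj).ne'; rw [transmissibility]; field_simp; norm_num)
  have h1 : ∑ j ∈ G.neighbors i, G.l i j * G.d i j * G.b v i j ^ 2 ≤
      G.bMaxSq v * (4 * G.V i) := by
    refine le_trans ?_ (mul_le_mul_of_nonneg_left (G.sum_l_mul_d_le hi) hB)
    rw [Finset.mul_sum]
    refine Finset.sum_le_sum fun j hj => ?_
    rw [mul_comm]
    exact mul_le_mul_of_nonneg_right (G.b_sq_le v hi hj)
      (mul_nonneg (G.l_nonneg i j) (hd j hj).le)
  have h2 : ∑ j ∈ G.neighbors i, G.transmissibility i j * (y j - y i) ^ 2 / 4 ≤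
      (∑ j, G.transmissibility i j * (y j - y i) ^ 2) / 4 := by
    rw [Finset.sum_div]
    exact Finset.sum_le_sum_of_subset_of_nonneg (Finset.subset_univ _) fun j _ _ =>
      div_nonneg (mul_nonneg (G.transmissibility_nonneg i j) (sq_nonneg _)) zero_le_four
  have h3 : (G.V i * G.C₁ v y i) ^ 2 ≤
      G.bMaxSq v * (4 * G.V i) * ((∑ j, G.transmissibility i j * (y j - y i) ^ 2) / 4) := by
    rw [G.V_mul_C₁ v y hi, ← G.sum_neighbors_l_mul_b]
    refine hCS.trans (mul_le_mul h1 h2 ?_ (by positivity))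
    exact Finset.sum_nonneg fun j _ =>
      div_nonneg (mul_nonneg (G.transmissibility_nonneg i j) (sq_nonneg _)) zero_le_four
  refine le_of_mul_le_mul_left ?_ hV
  calc G.V i * (G.V i * G.C₁ v y i ^ 2) = (G.V i * G.C₁ v y i) ^ 2 := by ring
    _ ≤ _ := h3
    _ = _ := by ring

/-! ### The discrete Friedrichs inequality -/

/-- The function `x ↦ -|x - c|² / 4` solves the discrete Poisson equation with right-hand side
`1`. -/
theorem sum_transmissibility_mul_dist_sq_sub {i : Fin M} (hmem : i ∈ G.interiorNodes)
    (hi : G.voronoiPolygon i ⊆ closure G.domain) (c : Plane) :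
    ∑ j, G.transmissibility i j * ((dist c (G.node j) ^ 2 - dist c (G.node i) ^ 2) / 4) =
      G.V i := by
  have h := G.sum_l_mul_height_eq_two_mul_V hmem hi c
  rw [← Finset.sum_erase (a := i) Finset.univ (by simp)]
  refine mul_left_cancel₀ two_ne_zero (h ▸ ?_)
  rw [Finset.mul_sum]
  refine Finset.sum_congr rfl fun j hj => ?_
  have h1 := G.inner_normal_sub_mid i j c
  rw [G.inner_normal_sub_mid_eq i j c, sub_self, inner_zero_right, zero_sub] at h1
  rw [← neg_neg (G.height c i j), h1, transmissibility]
  have hd := (G.d_pos (Finset.ne_of_mem_erase hj)).ne'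
  field_simp
  ring

/-- Barta's method: a positive supersolution `K - |x - c|² / 4 ≤ K` of the discrete Poisson
equation bounds the lowest eigenvalue from below by `1 / K`. -/
theorem norm_sq_le_mul_energy (hvor : ∀ i ∈ G.interiorNodes, G.voronoiPolygon i ⊆ closure G.domain)
    {c : Plane} {K : ℝ} (hK0 : 0 < K) (hK : ∀ i, dist c (G.node i) ^ 2 / 4 < K) (y : G.H) :
    ‖y‖ ^ 2 ≤ K / 2 * G.energy y := by
  set φ : Fin M → ℝ := fun i => K - dist c (G.node i) ^ 2 / 4 with hφ
  have hpos : ∀ i, 0 < φ i := fun i => sub_pos.2 (hK i)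
  have hle : ∀ i, φ i ≤ K := fun i => sub_le_self _ (by positivity)
  have hsum : ∑ i ∈ G.interiorNodes, G.V i * (y i ^ 2 / φ i) =
      ∑ i, (∑ j, G.transmissibility i j * (φ i - φ j)) * (y i ^ 2 / φ i) := by
    rw [← Finset.sum_subset (Finset.subset_univ G.interiorNodes)]
    · refine Finset.sum_congr rfl fun i hi => ?_
      rw [← G.sum_transmissibility_mul_dist_sq_sub hi (hvor i hi) c]
      congr 1
      exact Finset.sum_congr rfl fun j _ => by rw [hφ]; ring
    · exact fun i _ hi => by rw [y.2 i hi]; simp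
  have hE : ∑ i ∈ G.interiorNodes, G.V i * (y i ^ 2 / φ i) ≤ 1 / 2 * G.energy y := by
    rw [hsum, sum_mul_sum_mul_sub G.transmissibility_comm φ fun i => y i ^ 2 / φ i, energy]
    gcongr with i _ j _
    · exact G.transmissibility_nonneg i j
    · exact picone_inequality (hpos i) (hpos j)
  rw [G.norm_sq_eq]
  calc ∑ i ∈ G.interiorNodes, G.V i * y i ^ 2
      ≤ ∑ i ∈ G.interiorNodes, K * (G.V i * (y i ^ 2 / φ i)) := by
        refine Finset.sum_le_sum fun i hi => ?_
        have hV := (G.V_pos hi).le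
        have h1 : y i ^ 2 ≤ K * (y i ^ 2 / φ i) := by
          rw [← mul_div_assoc, le_div_iff₀ (hpos i), mul_comm]
          exact mul_le_mul_of_nonneg_right (hle i) (sq_nonneg _)
        nlinarith [mul_le_mul_of_nonneg_left h1 hV]
    _ ≤ K / 2 * G.energy y := by
        rw [← Finset.mul_sum]
        nlinarith [mul_le_mul_of_nonneg_left hE hK0.le]

/-- A point of a rectangle is at most half a diagonal away from its centre. -/
theorem dist_sq_center_le {a b : Fin 2 → ℝ} {x : Plane} (hx : ∀ α, a α ≤ x α ∧ x α ≤ b α) :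
    dist (WithLp.toLp 2 fun α => (a α + b α) / 2 : Plane) x ^ 2 / 4 ≤
      (b 0 - a 0) ^ 2 / 16 + (b 1 - a 1) ^ 2 / 16 := by
  rw [EuclideanSpace.dist_eq, Real.sq_sqrt (by positivity), Fin.sum_univ_two, Real.dist_eq,
    Real.dist_eq, sq_abs, sq_abs]
  have h : ∀ α, ((a α + b α) / 2 - x α) ^ 2 ≤ (b α - a α) ^ 2 / 4 := fun α => by
    nlinarith [mul_nonneg (sub_nonneg.2 (hx α).1) (sub_nonneg.2 (hx α).2)]
  have h0 := h 0
  have h1 := h 1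
  dsimp only
  linarith

theorem node_mem_rectangle {a b : Fin 2 → ℝ} (h : ∀ x ∈ G.domain, ∀ α, a α ≤ x α ∧ x α ≤ b α)
    (i : Fin M) (α : Fin 2) : a α ≤ G.node i α ∧ G.node i α ≤ b α := by
  have hcl : IsClosed {x : Plane | a α ≤ x α ∧ x α ≤ b α} :=
    isClosed_Icc.preimage (f := fun x : Plane => x α) (by fun_prop)
  exact closure_minimal (fun x hx => h x hx α) hcl (G.node_mem i)

/-- The discrete Friedrichs inequality. -/
theorem norm_sq_le_energy (hvor : ∀ i ∈ G.interiorNodes, G.voronoiPolygon i ⊆ closure G.domain)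
    {a b : Fin 2 → ℝ} (h : ∀ x ∈ G.domain, ∀ α, a α ≤ x α ∧ x α ≤ b α) (y : G.H) :
    ‖y‖ ^ 2 ≤ ((b 0 - a 0) ^ 2 / 16 + (b 1 - a 1) ^ 2 / 16) / 2 * G.energy y := by
  set M₀ := (b 0 - a 0) ^ 2 / 16 + (b 1 - a 1) ^ 2 / 16
  have hM₀ : 0 ≤ M₀ := by positivity
  have hlim : Tendsto (fun ε : ℝ => (M₀ + ε) / 2 * G.energy y) (𝓝[>] 0)
      (𝓝 (M₀ / 2 * G.energy y)) := by
    have h1 : ContinuousAt (fun ε : ℝ => (M₀ + ε) / 2 * G.energy y) 0 := by fun_prop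
    have h2 := h1.tendsto
    simp only [add_zero] at h2
    exact h2.mono_left nhdsWithin_le_nhds
  refine ge_of_tendsto hlim ?_
  filter_upwards [self_mem_nhdsWithin] with ε (hε : 0 < ε)
  exact G.norm_sq_le_mul_energy hvor (by positivity) (fun i =>
    (dist_sq_center_le (G.node_mem_rectangle h i)).trans_lt (lt_add_of_pos_right _ hε)) y

/-! ### Subordination to diffusion -/

/-- A perturbation of a grid function by a multiple of `(div_h v) y`, with Young's inequality in
the form `(r + s z)² ≤ (1 + s) r² + (s + s²) z²`. -/
theorem norm_sq_le_of_apply_eq (v : Plane → Plane) {A C y : G.H} {s : ℝ} (hs : 0 ≤ s)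
    (h : ∀ i ∈ G.interiorNodes, A i = C i + s * (G.divh v i * y i)) :
    ‖A‖ ^ 2 ≤ (1 + s) * ‖C‖ ^ 2 + (s + s ^ 2) * (G.divhNorm v ^ 2 * ‖y‖ ^ 2) := by
  simp only [G.norm_sq_eq, Finset.mul_sum]
  rw [← Finset.sum_add_distrib]
  refine Finset.sum_le_sum fun i hi => ?_
  have hV := (G.V_pos hi).le
  have hdiv : G.divh v i ^ 2 ≤ G.divhNorm v ^ 2 := by
    rw [← sq_abs]
    exact pow_le_pow_left₀ (abs_nonneg _) (G.abs_divh_le v hi) 2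
  have h1 : (C i + s * (G.divh v i * y i)) ^ 2 ≤
      (1 + s) * C i ^ 2 + (s + s ^ 2) * (G.divh v i * y i) ^ 2 := by
    nlinarith [mul_nonneg hs (sq_nonneg (C i - G.divh v i * y i))]
  have h2 : (s + s ^ 2) * (G.divh v i * y i) ^ 2 ≤
      (s + s ^ 2) * (G.divhNorm v ^ 2 * y i ^ 2) := by
    rw [mul_pow]
    gcongr
  rw [h i hi]
  nlinarith [mul_le_mul_of_nonneg_left (h1.trans (add_le_add_right h2 _)) hV]

theorem energy_le_of_pos {k : Plane → ℝ} {κ : ℝ} (hκ0 : 0 < κ) (hκ : ∀ x ∈ G.domain, κ ≤ k x)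
    (y : G.H) : G.energy y ≤ 2 / κ * inner ℝ (G.D k y) y := by
  rw [div_mul_eq_mul_div, le_div_iff₀ hκ0]
  linarith [G.energy_le_inner_D hκ y]

theorem inner_D_nonneg {k : Plane → ℝ} {κ : ℝ} (hκ0 : 0 < κ) (hκ : ∀ x ∈ G.domain, κ ≤ k x)
    (y : G.H) : 0 ≤ inner ℝ (G.D k y) y :=
  le_trans (mul_nonneg (by positivity) (G.energy_nonneg y)) (G.energy_le_inner_D hκ y)

end VoronoiGrid

theorem theorem7 {M : ℕ} (G : VoronoiGrid M) (v : Plane → Plane) :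
    -- adjointness
    LinearMap.adjoint (G.C₁ v) = -G.C₂ v ∧
    LinearMap.adjoint (G.C₀ v) = -G.C₀ v ∧
    -- boundedness of the energy
    (∀ y : G.H, |inner ℝ (G.C₁ v y) y| ≤ 1 / 2 * G.divhNorm v * ‖y‖ ^ 2) ∧
    (∀ y : G.H, |inner ℝ (G.C₂ v y) y| ≤ 1 / 2 * G.divhNorm v * ‖y‖ ^ 2) ∧
    -- subordination to the operator of diffusive transport
    (∀ (k : Plane → ℝ) (κ₁ : ℝ), 0 < κ₁ → (∀ x ∈ G.domain, κ₁ ≤ k x) →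
      (∀ y : G.H, ‖G.C₁ v y‖ ^ 2 ≤ 2 / κ₁ * G.bMaxSq v * inner ℝ (G.D k y) y) ∧
      -- the control volumes of the interior nodes are whole Voronoi polygons
      ((∀ i ∈ G.interiorNodes, G.voronoiPolygon i ⊆ closure G.domain) →
        ∀ (a b : Fin 2 → ℝ), (∀ x ∈ G.domain, ∀ α, a α ≤ x α ∧ x α ≤ b α) →
        ∀ M₀ : ℝ, M₀ = (b 0 - a 0) ^ 2 / 16 + (b 1 - a 1) ^ 2 / 16 →
        (∀ y : G.H, ‖G.C₂ v y‖ ^ 2 ≤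
          2 / κ₁ * (2 * G.bMaxSq v + M₀ * G.divhNorm v ^ 2) * inner ℝ (G.D k y) y) ∧
        (∀ y : G.H, ‖G.C₀ v y‖ ^ 2 ≤
          1 / κ₁ * (3 * G.bMaxSq v + M₀ * G.divhNorm v ^ 2) * inner ℝ (G.D k y) y))) := by
  refine ⟨G.adjoint_C₁ v, G.adjoint_C₀ v, G.abs_inner_C₁_le v, G.abs_inner_C₂_le v,
    fun k κ₁ hκ0 hκ => ⟨fun y => ?_, fun hvor a b hab M₀ hM₀ => ?_⟩⟩
  · have h := mul_le_mul_of_nonneg_left (G.energy_le_of_pos hκ0 hκ y) (G.bMaxSq_nonneg v)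
    refine (G.norm_C₁_sq_le v y).trans (h.trans_eq (by ring))
  have key : ∀ y : G.H, ∀ s : ℝ, 0 ≤ s →
      (1 + s) * ‖G.C₁ v y‖ ^ 2 + (s + s ^ 2) * (G.divhNorm v ^ 2 * ‖y‖ ^ 2) ≤
        ((1 + s) * G.bMaxSq v + (s + s ^ 2) / 2 * (M₀ * G.divhNorm v ^ 2)) *
          (2 / κ₁ * inner ℝ (G.D k y) y) := fun y s hs => by
    have hB := G.bMaxSq_nonneg v
    have hM : 0 ≤ M₀ := by rw [hM₀]; positivity
    have hF : ‖y‖ ^ 2 ≤ M₀ / 2 * G.energy y := by rw [hM₀]; exact G.norm_sq_le_energy hvor hab y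
    calc (1 + s) * ‖G.C₁ v y‖ ^ 2 + (s + s ^ 2) * (G.divhNorm v ^ 2 * ‖y‖ ^ 2)
        ≤ (1 + s) * (G.bMaxSq v * G.energy y) +
            (s + s ^ 2) * (G.divhNorm v ^ 2 * (M₀ / 2 * G.energy y)) := by
          gcongr
          exact G.norm_C₁_sq_le v y
      _ = ((1 + s) * G.bMaxSq v + (s + s ^ 2) / 2 * (M₀ * G.divhNorm v ^ 2)) * G.energy y := by
          ring
      _ ≤ _ := mul_le_mul_of_nonneg_left (G.energy_le_of_pos hκ0 hκ y) (by positivity)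
  constructor
  · intro y
    have h := G.norm_sq_le_of_apply_eq v (A := G.C₂ v y) (C := G.C₁ v y) (y := y) zero_le_one
      fun i hi => by rw [G.C₂_apply_eq v y hi, one_mul]
    exact (h.trans (key y 1 zero_le_one)).trans_eq (by ring)
  · intro y
    have h := G.norm_sq_le_of_apply_eq v (A := G.C₀ v y) (C := G.C₁ v y) (y := y) (s := 1 / 2)
      (by norm_num)
      fun i hi => G.C₀_apply_eq v y hi
    have hD := G.inner_D_nonneg hκ0 hκ y
    have hM : 0 ≤ M₀ := by rw [hM₀]; positivity
    refine (h.trans (key y (1 / 2) (by norm_num))).trans ?_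
    have h1 : 0 ≤ 1 / κ₁ * (M₀ * G.divhNorm v ^ 2) * inner ℝ (G.D k y) y := by positivity
    linear_combination 1 / 4 * h1
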